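/- **Definitions.** A *multiplicity sequence* is a nonincreasing sequence $M=(m_k)_{k\ge1}$ of positive integers, eventually equal to $1$, such that for every $k$ there is an integer $s_k\ge k+1$ (necessarily unique) with $m_k=\sum_{l=k+1}^{s_k}m_l$. For multiplicity sequences $M\ne M'$, with associated integers $s_k,s'_k$, put $\mathrm{Comp}(M,M')=\min\{\min(s_k,s'_k): s_k\neq s'_k\}$; put $\mathrm{Comp}(M,M)=+\infty$. A submonoid $S\subseteq\mathbb N^r$ is a *good semigroup* if (i) $\min(a,b)\in S$ (componentwise) for all $a,b\in S$; (ii) if $a,b\in S$ and $a[i]=b[i]$, there is $c\in S$ with $c[i]>a[i]$, $c[j]\ge\min(a[j],b[j])$ for all $j\ne i$, with equality if $a[j]\ne b[j]$; (iii) $\delta+\mathbb N^r\subseteq S$ for some $\delta\in S$. It is *local* if $0$ is its only element with a zero component, and *Arf* if for every $\alpha\in S$ the set $\{\beta-\alpha:\beta\in S,\ \beta\ge\alpha\}$ is closed under addition. If $\delta$ is the conductor of $S$ (the least vector with $\delta+\mathbb N^r\subseteq S$), the *genus* of $S$ is $d_1-d_2$, where $d_1$ (resp. $d_2$) is the length of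 a saturated chain from $0$ to $\delta$ in $\mathbb N^r$ (resp. in $S$). An *untwisted tree* $T_E=(p_1,\dots,p_{r-1})$ consists of an ordered collection $E=\{M_1,\dots,M_r\}$ of multiplicity sequences and integers $p_i\ge1$. Branches $i<h$ are glued at level $j\geq 1$ iff $j\le\min(p_i,\dots,p_{h-1})$ (and each branch is glued to itself). The node at level $j$ on branch $i$ is the vector whose $h$-th component is $M_h[j]$ if the branches $i$ and $h$ are glued at level $j$, and $0$ otherwise; it is shared by all branches glued to $i$ at level $j$. The tree is the *multiplicity tree* of $S$ if $S=\{0\}\cup\{\sum_{\mathbf n\in T'}\mathbf n\}$, where $T'$ runs over the finite subtrees of $T_E$ containing its root. For $n\in\mathbb Z$ let $\mathrm{Gen}(r,n)$ be the set of all untwisted trees with $r$ branches that are the multiplicity tree of some local Arf good semigroup of $\mathbb N^r$ of genus $n$. For $1\le t<r$, $p\ge1$ and $k\in\mathbb Z$, let $I_r^n(t,p,k)$ be the set of all untwisted trees $T_E=(p_1,\dots,p_{r-1})$ with $E=\{M_1,\dots,M_r\}$ such that the tree $(p_1,\dots,p_{t-1})$ on $\{M_1,\dots,M_t\}$ is in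 $\mathrm{Gen}(t,k)$, the tree $(p_{t+1},\dots,p_{r-1})$ on $\{M_{t+1},\dots,M_r\}$ is in $\mathrm{Gen}(r-t,n-p-k)$, and $p_t=p\le\mathrm{Comp}(M_t,M_{t+1})$. The inverse of $T_E=(p_1,\dots,p_{r-1})$ is the tree $(p_{r-1},\dots,p_1)$ on $\{M_r,\dots,M_1\}$, and $U^{-1}=\{T^{-1}:T\in U\}$ for a set $U$ of trees. **Proposition.** Let $r,n,t\in\mathbb N$ with $1\le t\le r/2$, and let $\lambda(p)$ be integers with $\lambda(p)\ge\frac{n-p-1}{2}$ for every integer $p$ with $1\le p\le n-r+2$. Then $$\mathrm{Gen}(r,n)=\bigcup_{p=1}^{n-r+2}\ \bigcup_{k=t-1}^{\lambda(p)}\Bigl(I_r^n(t,p,k)\cup\bigl(I_r^n(t,p,k)\bigr)^{-1}\Bigr).$$ -/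

import Mathlib

/-- A multiplicity sequence `m₁ ≥ m₂ ≥ ⋯` of positive integers. The entry `m_{j+1}` is `seq j`.
With this shift, `∑_{l=k+1}^{s} m_l` is the sum of `seq` over `Finset.Ico k s`. -/
@[ext]
structure MultSeq where
  seq : ℕ → ℕ
  pos : ∀ j, 0 < seq j
  anti : Antitone seq
  eventually_one : ∃ K, ∀ j, K ≤ j → seq j = 1
  sum_eq : ∀ j, ∃ s, j + 2 ≤ s ∧ seq j = ∑ l ∈ Finset.Ico (j + 1) s, seq l

/-- The integer `s_k` with `m_k = ∑_{l=k+1}^{s_k} m_l`, for `k = j + 1`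
(it is unique, as the entries are positive). -/
def MultSeq.sumEnd (M : MultSeq) (j : ℕ) : ℕ := Nat.find (M.sum_eq j)

open Classical in
/-- The compatibility `Comp(M₁, M₂)`: the minimum of `min (s_{1,k}, s_{2,k})` over the `k` with
`s_{1,k} ≠ s_{2,k}`, and `+∞` if `M₁ = M₂`. -/
noncomputable def Comp (M₁ M₂ : MultSeq) : ℕ∞ :=
  if M₁ = M₂ then ⊤
  else ⨅ (j : ℕ) (_ : M₁.sumEnd j ≠ M₂.sumEnd j),
    ((min (M₁.sumEnd j) (M₂.sumEnd j) : ℕ) : ℕ∞)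

/-- A good semigroup of `ℕ^r`. -/
structure IsGoodSemigroup {r : ℕ} (S : AddSubmonoid (Fin r → ℕ)) : Prop where
  inf_mem : ∀ a ∈ S, ∀ b ∈ S, a ⊓ b ∈ S
  exists_gt : ∀ a ∈ S, ∀ b ∈ S, ∀ i, a i = b i →
    ∃ c ∈ S, a i < c i ∧
      (∀ j, j ≠ i → min (a j) (b j) ≤ c j) ∧
      (∀ j, j ≠ i → a j ≠ b j → c j = min (a j) (b j))
  exists_cone : ∃ δ ∈ S, ∀ x, δ ≤ x → x ∈ S

/-- The zero vector is the only element with a zero component. -/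
def IsLocalSemigroup {r : ℕ} (S : AddSubmonoid (Fin r → ℕ)) : Prop :=
  ∀ a ∈ S, (∃ i, a i = 0) → a = 0

/-- For every `α ∈ S`, the set `S(α) - α`, where `S(α) = {β ∈ S | β ≥ α}`, is closed under
addition. -/
def IsArfSemigroup {r : ℕ} (S : AddSubmonoid (Fin r → ℕ)) : Prop :=
  ∀ α ∈ S, ∀ x y : Fin r → ℕ, α + x ∈ S → α + y ∈ S → α + (x + y) ∈ S

/-- `δ` is the conductor of `S`: the least vector with `δ + ℕ^r ⊆ S`. -/
def IsConductor {r : ℕ} (S : AddSubmonoid (Fin r → ℕ)) (δ : Fin r → ℕ) : Prop :=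
  IsLeast {c : Fin r → ℕ | ∀ x, c ≤ x → x ∈ S} δ

/-- There is a saturated chain `a = α₀ < α₁ < ⋯ < α_n = b` of length `n` in `S`
(no element of `S` lies strictly between two consecutive terms). -/
def HasSaturatedChain {r : ℕ} (S : Set (Fin r → ℕ)) (a b : Fin r → ℕ) (n : ℕ) : Prop :=
  ∃ α : Fin (n + 1) → Fin r → ℕ, (∀ i, α i ∈ S) ∧ α 0 = a ∧ α (Fin.last n) = b ∧
    ∀ i : Fin n, α i.castSucc < α i.succ ∧ ∀ s ∈ S, ¬ (α i.castSucc < s ∧ s < α i.succ)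

/-- `S` has genus `g = d(ℕ^r ∖ C) - d(S ∖ C)`, where `C = δ + ℕ^r`, `δ` is the conductor of `S`, and
`d(E ∖ C)` is the length of a saturated chain in `E` from `0` to `δ`. -/
def HasGenus {r : ℕ} (S : AddSubmonoid (Fin r → ℕ)) (g : ℤ) : Prop :=
  ∃ δ, IsConductor S δ ∧ ∃ d₁ d₂ : ℕ,
    HasSaturatedChain Set.univ 0 δ d₁ ∧ HasSaturatedChain (S : Set (Fin r → ℕ)) 0 δ d₂ ∧
    g = (d₁ : ℤ) - d₂

/-- An untwisted tree `T_E = (p₁, …, p_{r-1})` with `r` branches, where `E = {M₁, …, M_r}` is an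
ordered collection of multiplicity sequences (those along the branches) and `p_i ≥ 1` is the highest
level at which the branches `i` and `i + 1` are glued. Here `M_{i+1} = E i`, `p_{i+1} = p i`. -/
@[ext]
structure UntwistedTree (r : ℕ) where
  E : Fin r → MultSeq
  p : Fin (r - 1) → ℕ
  p_pos : ∀ i, 1 ≤ p i

namespace UntwistedTree

variable {r : ℕ}

/-- The branches `i` and `h` are glued at level `j + 1`: all the consecutive branches between them
are glued at that level. -/
def Glued (T : UntwistedTree r) (i h : Fin r) (j : ℕ) : Prop :=
  ∀ m : Fin (r - 1), min (i : ℕ) (h : ℕ) ≤ (m : ℕ) → (m : ℕ) < max (i : ℕ) (h : ℕ) →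
    j + 1 ≤ T.p m

open Classical in
/-- The node, a vector of `ℕ^r`, on the branch `i` at level `j + 1`: its `h`-th coordinate is the
entry of `M_h` at that level if the branch `h` passes through the node, and `0` otherwise. -/
noncomputable def node (T : UntwistedTree r) (i : Fin r) (j : ℕ) : Fin r → ℕ :=
  fun h => if T.Glued i h j then (T.E h).seq j else 0

/-- A finite subtree of `T` rooted in the root of `T`, as a finite set of nodes that contains the
root and, with a node, its parent. A node is recorded together with its level: nodes on one level
are told apart by their supports, nodes on different levels may be equal as vectors. -/
structure IsRootedSubtree (T : UntwistedTree r) (V : Finset (ℕ × (Fin r → ℕ))) : Prop where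
  subset : ∀ v ∈ V, ∃ i j, v = (j, T.node i j)
  root_mem : ∀ i, (0, T.node i 0) ∈ V
  parent_mem : ∀ i j, (j + 1, T.node i (j + 1)) ∈ V → (j, T.node i j) ∈ V

/-- `T` is the multiplicity tree of `S`: the nonzero elements of `S` are the sums of the nodes of the
finite subtrees of `T` rooted in the root of `T`. -/
def IsMultiplicityTreeOf (T : UntwistedTree r) (S : AddSubmonoid (Fin r → ℕ)) : Prop :=
  (S : Set (Fin r → ℕ)) = {0} ∪ {x | ∃ V, T.IsRootedSubtree V ∧ x = ∑ v ∈ V, v.2}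

/-- The tree `T_{E_t} = (p₁, …, p_{t-1})` with `E_t = {M₁, …, M_t}`. -/
def take (T : UntwistedTree r) (t : ℕ) (h : t ≤ r) : UntwistedTree t where
  E i := T.E ⟨i, by omega⟩
  p i := T.p ⟨i, by omega⟩
  p_pos _ := T.p_pos _

/-- The tree `T_{E^t} = (p_{t+1}, …, p_{r-1})` with `E^t = {M_{t+1}, …, M_r}`. -/
def drop (T : UntwistedTree r) (t : ℕ) : UntwistedTree (r - t) where
  E i := T.E ⟨t + i, by omega⟩
  p i := T.p ⟨t + i, by omega⟩
  p_pos _ := T.p_pos _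

/-- The tree `T⁻¹ = (p_{r-1}, …, p₁)` with `E⁻¹ = {M_r, …, M₁}`. -/
def reverse (T : UntwistedTree r) : UntwistedTree r where
  E i := T.E i.rev
  p i := T.p i.rev
  p_pos _ := T.p_pos _

end UntwistedTree

/-- `Gen(r, n)`: the untwisted multiplicity trees of the local Arf good semigroups of `ℕ^r` of
genus `n`. The second argument is an integer, so that differences of indices do not truncate. -/
def Gen (r : ℕ) (n : ℤ) : Set (UntwistedTree r) :=
  {T | ∃ S : AddSubmonoid (Fin r → ℕ), IsGoodSemigroup S ∧ IsLocalSemigroup S ∧ IsArfSemigroup S ∧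
    T.IsMultiplicityTreeOf S ∧ HasGenus S n}

/-- `I_r^n(t, p, k)`: the trees `T_E = (p₁, …, p_{r-1})` with `T_{E_t} ∈ Gen(t, k)`,
`T_{E^t} ∈ Gen(r - t, n - p - k)` and `p_t = p ≤ Comp(M_t, M_{t+1})`. -/
def ISet (r : ℕ) (n : ℤ) (t p : ℕ) (k : ℤ) (ht : 1 ≤ t) (htr : t < r) : Set (UntwistedTree r) :=
  {T | T.take t htr.le ∈ Gen t k ∧ T.drop t ∈ Gen (r - t) (n - p - k) ∧
    T.p ⟨t - 1, by omega⟩ = p ∧ (p : ℕ∞) ≤ Comp (T.E ⟨t - 1, by omega⟩) (T.E ⟨t, htr⟩)}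

/-! Finite rooted subtrees of `T` are encoded by depth vectors `d`, with node sum given by the
partial sums `psum (d h)`. The tree comes from a local Arf good semigroup iff each `p_m` is at most
the `Comp` of the two sequences it joins, and then the genus is `∑_h ∑_k (m_{h,k} - 1) + ∑_m p_m`
(`mem_gen_iff`).

Both the condition and the genus split when the tree is cut after branch `t`, so `ISet` selects the
trees of `Gen r n` with `p_t = p` and left genus `k` (`mem_iSet_iff`). Since every `p_m ≥ 1`, a tree
with `r` branches has genus at least `r - 1`, which bounds `p` and `k`.

`Gen r n` is stable under reversal. Let `k, p` and `k', p'` be the data of `T` and `T⁻¹`. As `2t ≤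
r`, the first and last `t` branches are disjoint, so `k + p + k' = n` with `p = p'`, or `k + p + p'
+ k' ≤ n`. Either excludes having both `k > λ(p)` and `k' > λ(p')`. -/

/-! ### Multiplicity sequences: partial sums and compatibility. -/

/-- The sum of the first `n` entries of a multiplicity sequence. -/
def MultSeq.psum (M : MultSeq) (n : ℕ) : ℕ := ∑ l ∈ Finset.range n, M.seq l

namespace MultSeq

variable (M M' : MultSeq)

@[simp] lemma psum_zero : M.psum 0 = 0 := by simp [psum]

lemma psum_succ (n : ℕ) : M.psum (n + 1) = M.psum n + M.seq n := Finset.sum_range_succ _ _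

lemma psum_strictMono : StrictMono M.psum :=
  strictMono_nat_of_lt_succ fun n => by
    have := M.pos n
    rw [psum_succ]; omega

lemma psum_inj {a b : ℕ} : M.psum a = M.psum b ↔ a = b := M.psum_strictMono.injective.eq_iff

lemma psum_le {a b : ℕ} : M.psum a ≤ M.psum b ↔ a ≤ b := M.psum_strictMono.le_iff_le

lemma add_two_le_sumEnd (j : ℕ) : j + 2 ≤ M.sumEnd j := (Nat.find_spec (M.sum_eq j)).1

lemma psum_sumEnd (j : ℕ) : M.psum (M.sumEnd j) = M.psum (j + 1) + M.seq j := by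
  have h := Nat.find_spec (M.sum_eq j)
  have h2 : M.seq j = ∑ l ∈ Finset.Ico (j + 1) (M.sumEnd j), M.seq l := h.2
  have h3 := M.add_two_le_sumEnd j
  rw [h2, psum, psum, Finset.range_eq_Ico, Finset.range_eq_Ico,
    Finset.sum_Ico_consecutive _ (by omega) (by omega)]

lemma eq_one_of_le {a b : ℕ} (ha : M.seq a = 1) (h : a ≤ b) : M.seq b = 1 := by
  have := M.anti h
  have := M.pos b
  omega

lemma psum_add_of_eq_one {a : ℕ} (ha : M.seq a = 1) (x : ℕ) : M.psum (a + x) = M.psum a + x := by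
  induction x with
  | zero => rfl
  | succ x ih => rw [← add_assoc, psum_succ, ih, M.eq_one_of_le ha (by omega), add_assoc]

/-- The one-branch Arf property. -/
lemma exists_psum_eq {a b c : ℕ} (hb : a ≤ b) (hc : a ≤ c) :
    ∃ e, M.psum e + M.psum a = M.psum b + M.psum c := by
  -- Descending induction on `a`, starting in the tail of ones, where `psum` is affine.
  obtain ⟨K, hK⟩ := M.eventually_one
  suffices ∀ n a b c : ℕ, K ≤ a + n → a ≤ b → a ≤ c →
      ∃ e, M.psum e + M.psum a = M.psum b + M.psum c from this K a b c (by omega) hb hc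
  intro n
  induction n with
  | zero =>
    intro a b c ha hb hc
    obtain ⟨x, rfl⟩ := Nat.exists_eq_add_of_le hb
    obtain ⟨y, rfl⟩ := Nat.exists_eq_add_of_le hc
    have h1 := hK a (by omega)
    refine ⟨a + (x + y), ?_⟩
    simp only [M.psum_add_of_eq_one h1]
    omega
  | succ n ih =>
    intro a b c ha hb hc
    rcases hb.eq_or_lt with rfl | hb
    · exact ⟨c, add_comm _ _⟩
    rcases hc.eq_or_lt with rfl | hc
    · exact ⟨b, rfl⟩
    obtain ⟨e, he⟩ := ih (a + 1) b c (by omega) hb hc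
    have h1 := M.psum_le.2 (Nat.succ_le_of_lt hb)
    have h2 := M.psum_le.2 (Nat.succ_le_of_lt hc)
    have h3 : a + 1 ≤ e := M.psum_le.1 (by simp only [Nat.succ_eq_add_one] at *; omega)
    have h4 := M.add_two_le_sumEnd a
    -- Moving the base from `a + 1` back to `a` adds `seq a`, which is `psum (sumEnd a) - psum (a +
    -- 1)`: again an Arf sum based at `a + 1`.
    obtain ⟨e', he'⟩ := ih (a + 1) (M.sumEnd a) e (by omega) (by omega) h3
    refine ⟨e', ?_⟩
    have := M.psum_sumEnd a
    have := M.psum_succ a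
    omega

variable {M M'}

/-- Two distinct ends have equal truncations at `p` exactly when both are at least `p`. The right
side has the shape of `IsDepth`. -/
lemma le_comp_iff {p : ℕ} :
    (p : ℕ∞) ≤ Comp M M' ↔ ∀ j, min (M.sumEnd j) p = min (M'.sumEnd j) p := by
  unfold Comp
  split_ifs with h
  · simp [h]
  · simp only [le_iInf_iff, Nat.cast_le]
    refine forall_congr' fun j => ?_
    omega

lemma comp_comm : Comp M M' = Comp M' M := by
  refine eq_of_forall_le_iff fun c => ?_
  induction c using ENat.recTopCoe with
  | top =>
    unfold Comp
    by_cases h : M = M'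
    · simp [h]
    · rw [if_neg h, if_neg (Ne.symm h)]
      simp only [ne_comm, min_comm]
  | coe p => simp only [le_comp_iff, eq_comm]

/-- The operation of `exists_psum_eq` respects the gluing of two compatible branches. -/
lemma min_eq_min_of_psum {p : ℕ} (h : ∀ j, min (M.sumEnd j) p = min (M'.sumEnd j) p)
    {a a' b b' c c' e e' : ℕ} (ha : min a p = min a' p) (hb : min b p = min b' p)
    (hc : min c p = min c' p) (hab : a ≤ b) (hac : a ≤ c) (hab' : a' ≤ b') (hac' : a' ≤ c')
    (he : M.psum e + M.psum a = M.psum b + M.psum c)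
    (he' : M'.psum e' + M'.psum a' = M'.psum b' + M'.psum c') : min e p = min e' p := by
  suffices ∀ n a a' b b' c c' e e' : ℕ, p ≤ a + n → min a p = min a' p → min b p = min b' p →
      min c p = min c' p → a ≤ b → a ≤ c → a' ≤ b' → a' ≤ c' →
      M.psum e + M.psum a = M.psum b + M.psum c →
      M'.psum e' + M'.psum a' = M'.psum b' + M'.psum c' → min e p = min e' p from
    this p _ _ _ _ _ _ _ _ (by omega) ha hb hc hab hac hab' hac' he he'
  -- Past level `p` nothing is left to compare: `e ≥ b ≥ a ≥ p`, and likewise for the primed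
  -- indices.
  have key : ∀ a a' b b' c c' e e' : ℕ, p ≤ a → min a p = min a' p → a ≤ b → a ≤ c → a' ≤ b' →
      a' ≤ c' → M.psum e + M.psum a = M.psum b + M.psum c →
      M'.psum e' + M'.psum a' = M'.psum b' + M'.psum c' → min e p = min e' p := by
    intro a a' b b' c c' e e' hpa ha hab hac hab' hac' he he'
    have h1 : b ≤ e := M.psum_le.1 (by have := M.psum_le.2 hac; omega)
    have h2 : b' ≤ e' := M'.psum_le.1 (by have := M'.psum_le.2 hac'; omega)
    omega
  intro n
  induction n with
  | zero =>
    intro a a' b b' c c' e e' hp ha _ _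
    exact key a a' b b' c c' e e' hp ha
  | succ n ih =>
    intro a a' b b' c c' e e' hp ha hb hc hab hac hab' hac' he he'
    rcases le_or_gt p a with hpa | hpa
    · exact key a a' b b' c c' e e' hpa ha hab hac hab' hac' he he'
    obtain rfl : a = a' := by omega
    rcases hab.eq_or_lt with rfl | hab
    · obtain rfl : a = b' := by omega
      obtain rfl : e = c := M.psum_inj.1 (by omega)
      obtain rfl : e' = c' := M'.psum_inj.1 (by omega)
      exact hc
    rcases hac.eq_or_lt with rfl | hac
    · obtain rfl : a = c' := by omega
      obtain rfl : e = b := M.psum_inj.1 (by omega)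
      obtain rfl : e' = b' := M'.psum_inj.1 (by omega)
      exact hb
    have hab2 : a + 1 ≤ b' := by omega
    have hac2 : a + 1 ≤ c' := by omega
    obtain ⟨f, hf⟩ := M.exists_psum_eq (a := a + 1) hab hac
    obtain ⟨f', hf'⟩ := M'.exists_psum_eq (a := a + 1) hab2 hac2
    have h1 := ih (a + 1) (a + 1) b b' c c' f f' (by omega) rfl hb hc hab hac hab2 hac2 hf hf'
    have h2 : a + 1 ≤ f := M.psum_le.1 (by
      have h3 : M.psum (a + 1) ≤ _ := M.psum_le.2 hab
      have h4 : M.psum (a + 1) ≤ _ := M.psum_le.2 hac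
      omega)
    have h2' : a + 1 ≤ f' := M'.psum_le.1 (by
      have h3 := M'.psum_le.2 hab2
      have h4 := M'.psum_le.2 hac2
      omega)
    have h3 := M.add_two_le_sumEnd a
    have h3' := M'.add_two_le_sumEnd a
    have h4 := M.psum_sumEnd a
    have h4' := M'.psum_sumEnd a
    have h5 := M.psum_succ a
    have h5' := M'.psum_succ a
    -- The recursion of `exists_psum_eq` run on both branches at once; compatibility enters only
    -- through `h a`.
    exact ih (a + 1) (a + 1) (M.sumEnd a) (M'.sumEnd a) f f' e e' (by omega) rfl (h a) h1
      (by omega) h2 (by omega) h2' (by omega) (by omega)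

lemma exists_seq_eq_one (M : MultSeq) : ∃ K, M.seq K = 1 :=
  let ⟨K, hK⟩ := M.eventually_one
  ⟨K, hK K le_rfl⟩

/-- The first index at which a multiplicity sequence takes the value `1`. -/
noncomputable def onset (M : MultSeq) : ℕ := Nat.find M.exists_seq_eq_one

lemma seq_onset (M : MultSeq) : M.seq M.onset = 1 := Nat.find_spec M.exists_seq_eq_one

lemma onset_le {N : ℕ} (h : M.seq N = 1) : M.onset ≤ N := Nat.find_min' M.exists_seq_eq_one h

/-- The genus `∑ (m_k - 1)` of the numerical semigroup with a given multiplicity sequence. -/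
noncomputable def genus (M : MultSeq) : ℤ := M.psum M.onset - M.onset

lemma genus_eq {N : ℕ} (h : M.seq N = 1) : M.genus = M.psum N - N := by
  obtain ⟨x, rfl⟩ := Nat.exists_eq_add_of_le (onset_le h)
  rw [genus, M.psum_add_of_eq_one M.seq_onset]
  push_cast
  ring

lemma genus_nonneg (M : MultSeq) : 0 ≤ M.genus := by
  have := M.psum_strictMono.le_apply (x := M.onset)
  rw [genus]
  omega

end MultSeq

/-! ### Lengths of saturated chains. -/

section Chains

variable {r : ℕ} {S : Set (Fin r → ℕ)}

/-- `R` acts as a rank function: a consecutive pair of the chain admits nothing strictly between, so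
`c` is its upper end and `R` rises by exactly one. -/
lemma HasSaturatedChain.length_eq {R : (Fin r → ℕ) → ℤ}
    (hR : ∀ a ∈ S, ∀ b ∈ S, a < b → ∃ c ∈ S, a < c ∧ c ≤ b ∧ R c = R a + 1)
    {a b : Fin r → ℕ} {n : ℕ} (h : HasSaturatedChain S a b n) : (n : ℤ) = R b - R a := by
  obtain ⟨α, hS, h0, hn, hc⟩ := h
  have hstep : ∀ i : Fin n, R (α i.succ) = R (α i.castSucc) + 1 := by
    intro i
    obtain ⟨c, hcS, h1, h2, h3⟩ := hR _ (hS i.castSucc) _ (hS i.succ) (hc i).1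
    rcases h2.eq_or_lt with rfl | h2
    · exact h3
    · exact absurd ⟨h1, h2⟩ ((hc i).2 c hcS)
  have : ∀ i : Fin (n + 1), R (α i) = R (α 0) + (i : ℕ) := by
    intro i
    induction i using Fin.induction with
    | zero => simp
    | succ i ih =>
      rw [hstep, ih]
      simp only [Fin.val_castSucc, Fin.val_succ]
      push_cast
      ring
  have h2 := this (Fin.last n)
  rw [h0, hn, Fin.val_last] at h2
  omega

lemma HasSaturatedChain.cons {a b c : Fin r → ℕ} {n : ℕ} (ha : a ∈ S) (hab : a < b)
    (hcov : ∀ s ∈ S, ¬(a < s ∧ s < b)) (h : HasSaturatedChain S b c n) :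
    HasSaturatedChain S a c (n + 1) := by
  obtain ⟨α, hS, h0, hn, hc⟩ := h
  refine ⟨Fin.cons a α, ?_, rfl, ?_, ?_⟩
  · intro i
    cases i using Fin.cases with
    | zero => exact ha
    | succ i => exact hS i
  · rw [← Fin.succ_last, Fin.cons_succ, hn]
  · intro i
    cases i using Fin.cases with
    | zero =>
      simp only [Fin.castSucc_zero, Fin.cons_zero, Fin.cons_succ, h0]
      exact ⟨hab, hcov⟩
    | succ i =>
      rw [← Fin.succ_castSucc, Fin.cons_succ, Fin.cons_succ]
      exact hc i

lemma exists_hasSaturatedChain {a b : Fin r → ℕ} (ha : a ∈ S) (hb : b ∈ S) (hab : a ≤ b) :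
    ∃ n, HasSaturatedChain S a b n := by
  induction hN : ∑ i, (b i - a i) using Nat.strong_induction_on generalizing a with
  | _ N ih =>
    rcases hab.eq_or_lt with rfl | hlt
    · exact ⟨0, fun _ => a, fun _ => ha, rfl, rfl, fun i => i.elim0⟩
    obtain ⟨c, ⟨hcS, hac, hcb⟩, hmin⟩ :=
      wellFounded_lt.has_min {c | c ∈ S ∧ a < c ∧ c ≤ b} ⟨b, hb, hlt, le_rfl⟩
    have hlt' : ∑ i, (b i - c i) < N := by
      rw [← hN]
      obtain ⟨hle, i, hi⟩ := Pi.lt_def.1 hac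
      refine Finset.sum_lt_sum (fun i _ => ?_) ⟨i, Finset.mem_univ i, ?_⟩
      · exact Nat.sub_le_sub_left (hle i) _
      · have h1 : c i ≤ b i := hcb i
        change b i - c i < b i - a i
        omega
    obtain ⟨n, hn⟩ := ih _ hlt' hcS hcb rfl
    exact ⟨n + 1, hn.cons ha hac fun s hs h => hmin s ⟨hs, h.1, h.2.le.trans hcb⟩ h.2⟩

lemma length_eq_of_hasSaturatedChain_univ {δ : Fin r → ℕ} {n : ℕ}
    (h : HasSaturatedChain Set.univ 0 δ n) : (n : ℤ) = ∑ i, (δ i : ℤ) := by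
  rw [h.length_eq (R := fun x => ∑ i, (x i : ℤ))]
  · simp
  · intro a _ b _ hab
    obtain ⟨hle, i, hi⟩ := Pi.lt_def.1 hab
    refine ⟨a + Pi.single i 1, trivial, ?_, ?_, ?_⟩
    · refine Pi.lt_def.2 ⟨fun j => by simp, i, by simp⟩
    · intro j
      by_cases hj : j = i
      · subst hj
        simpa using hi
      · simpa [hj] using hle j
    · simp [Finset.sum_add_distrib, Pi.single_apply]

end Chains
-- Gluing, and subtrees as depth vectors.
namespace UntwistedTree

variable {r : ℕ}

/-- The branch `m`, seen as the left one of the adjacent branches `m`, `m + 1`. -/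
def left (m : Fin (r - 1)) : Fin r := ⟨m, by omega⟩

/-- The right one of the adjacent branches `m`, `m + 1`. -/
def right (m : Fin (r - 1)) : Fin r := ⟨m + 1, by omega⟩

@[simp] lemma val_left (m : Fin (r - 1)) : (left m : ℕ) = m := rfl

@[simp] lemma val_right (m : Fin (r - 1)) : (right m : ℕ) = m + 1 := rfl

variable (T : UntwistedTree r)

lemma glued_refl (i : Fin r) (j : ℕ) : T.Glued i i j := fun m h1 h2 => by omega

variable {T}

lemma Glued.symm {i h : Fin r} {j : ℕ} (H : T.Glued i h j) : T.Glued h i j :=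
  fun m h1 h2 => H m (by omega) (by omega)

lemma Glued.trans {i h k : Fin r} {j : ℕ} (H : T.Glued i h j) (H' : T.Glued h k j) :
    T.Glued i k j := by
  intro m h1 h2
  by_cases h3 : min (i : ℕ) h ≤ m ∧ (m : ℕ) < max (i : ℕ) h
  · exact H m h3.1 h3.2
  · exact H' m (by omega) (by omega)

lemma Glued.mono {i h : Fin r} {j j' : ℕ} (H : T.Glued i h j) (hj : j' ≤ j) : T.Glued i h j' :=
  fun m h1 h2 => by have := H m h1 h2; omega

lemma glued_left_right {m : Fin (r - 1)} {j : ℕ} : T.Glued (left m) (right m) j ↔ j < T.p m := by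
  constructor
  · intro H
    exact H m (by simp) (by simp)
  · intro H m' h1 h2
    obtain rfl : m' = m := Fin.ext (by simp only [val_left, val_right] at h1 h2; omega)
    exact H

lemma glued_zero (i h : Fin r) : T.Glued i h 0 := fun m _ _ => T.p_pos m

lemma Glued.node_eq {i h : Fin r} {j : ℕ} (H : T.Glued i h j) : T.node i j = T.node h j := by
  funext k
  have : T.Glued i k j ↔ T.Glued h k j := ⟨H.symm.trans, H.trans⟩
  by_cases hk : T.Glued i k j
  · simp [node, hk, this.1 hk]
  · simp [node, hk, mt this.2 hk]

lemma node_self (i : Fin r) (j : ℕ) : T.node i j i = (T.E i).seq j := by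
  simp [node, T.glued_refl]

lemma glued_of_node_ne_zero {i h : Fin r} {j : ℕ} (H : T.node i j h ≠ 0) : T.Glued i h j := by
  by_contra h'
  exact H (if_neg h')

variable (T) in
/-- The depth vectors of the finite rooted subtrees of `T`: adjacent branches have the same depth, or
both depths are at least the level up to which they are glued. -/
def IsDepth (d : Fin r → ℕ) : Prop :=
  ∀ m : Fin (r - 1), min (d (left m)) (T.p m) = min (d (right m)) (T.p m)

lemma IsDepth.lt_iff_of_glued {d : Fin r → ℕ} (hd : T.IsDepth d) {i h : Fin r} {j : ℕ}
    (H : T.Glued i h j) : j < d i ↔ j < d h := by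
  have key : ∀ b a : ℕ, a ≤ b → ∀ (ha : a < r) (hb : b < r), T.Glued ⟨a, ha⟩ ⟨b, hb⟩ j →
      (j < d ⟨a, ha⟩ ↔ j < d ⟨b, hb⟩) := by
    intro b a hab
    induction b, hab using Nat.le_induction with
    | base => exact fun _ _ _ => Iff.rfl
    | succ b hab ih =>
      intro ha hb H
      have h1 := ih ha (by omega) fun m h1 h2 => H m (by simp only at *; omega) (by simp only at *; omega)
      rw [h1]
      have h2 := hd ⟨b, by omega⟩
      have h3 := H ⟨b, by omega⟩ (by simp only; omega) (by simp only; omega)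
      simp only [left, right] at h2
      omega
  rcases le_total (i : ℕ) h with hle | hle
  · exact key h i hle i.2 h.2 H
  · exact (key i h hle h.2 i.2 H.symm).symm

variable (T) in
/-- The sum of the nodes up to depth `d h` on each branch `h`. -/
def depthSum (d : Fin r → ℕ) : Fin r → ℕ := fun h => (T.E h).psum (d h)

lemma depthSum_le {d d' : Fin r → ℕ} : T.depthSum d ≤ T.depthSum d' ↔ d ≤ d' :=
  forall_congr' fun _ => MultSeq.psum_le _

lemma depthSum_injective : Function.Injective T.depthSum := fun _ _ h =>
  funext fun i => (MultSeq.psum_inj _).1 (congrFun h i)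

lemma depthSum_lt {d d' : Fin r → ℕ} : T.depthSum d < T.depthSum d' ↔ d < d' := by
  rw [lt_iff_le_not_ge, lt_iff_le_not_ge, depthSum_le, depthSum_le]

@[simp] lemma depthSum_zero : T.depthSum 0 = 0 := funext fun _ => MultSeq.psum_zero _

lemma isDepth_zero : T.IsDepth 0 := fun _ => rfl

/-- Only nodes lying on branch `h` contribute to coordinate `h`, and their levels are those below `d
h`. -/
lemma sum_nodes_eq_depthSum {V : Finset (ℕ × (Fin r → ℕ))} {d : Fin r → ℕ}
    (hV : ∀ v ∈ V, ∃ i j, v = (j, T.node i j)) (hd : ∀ h j, (j, T.node h j) ∈ V ↔ j < d h) :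
    ∑ v ∈ V, v.2 = T.depthSum d := by
  classical
  funext h
  rw [Finset.sum_apply, depthSum, MultSeq.psum]
  have hsub : (Finset.range (d h)).image (fun j => (j, T.node h j)) ⊆ V := by
    intro v hv
    obtain ⟨j, hj, rfl⟩ := Finset.mem_image.1 hv
    exact (hd h j).2 (Finset.mem_range.1 hj)
  rw [← Finset.sum_subset hsub, Finset.sum_image]
  · exact Finset.sum_congr rfl fun j _ => node_self h j
  · intro a _ b _ hab
    exact congrArg Prod.fst hab
  · intro v hv hv'
    obtain ⟨i, j, rfl⟩ := hV v hv
    by_contra hne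
    have heq := (glued_of_node_ne_zero hne).node_eq
    rw [heq] at hv hv'
    exact hv' (Finset.mem_image.2 ⟨j, Finset.mem_range.2 ((hd h j).1 hv), rfl⟩)

/-- The depth of a branch is its first level missing from `V`. Adjacent branches share their nodes
below level `p`, so these depths agree when truncated at `p`. -/
lemma IsRootedSubtree.exists_isDepth {V : Finset (ℕ × (Fin r → ℕ))} (hV : T.IsRootedSubtree V) :
    ∃ d, T.IsDepth d ∧ ∑ v ∈ V, v.2 = T.depthSum d := by
  classical
  have hex : ∀ h, ∃ j, (j, T.node h j) ∉ V := by
    intro h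
    by_contra! H
    exact (Set.infinite_range_of_injective (f := fun j => (j, T.node h j))
      fun a b hab => congrArg Prod.fst hab) (V.finite_toSet.subset
        (by rintro _ ⟨j, rfl⟩; exact H j))
  have hdown : ∀ h j k, k ≤ j → (j, T.node h j) ∈ V → (k, T.node h k) ∈ V := by
    intro h j k hk
    induction j, hk using Nat.le_induction with
    | base => exact id
    | succ j _ ih => exact fun H => ih (hV.parent_mem h j H)
  have hd : ∀ h j, (j, T.node h j) ∈ V ↔ j < Nat.find (hex h) := by
    intro h j
    constructor
    · intro H
      by_contra! hle
      exact Nat.find_spec (hex h) (hdown h _ _ hle H)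
    · intro H
      simpa using Nat.find_min (hex h) H
  refine ⟨fun h => Nat.find (hex h), fun m => ?_, sum_nodes_eq_depthSum hV.subset hd⟩
  have h1 : ∀ j < T.p m, j < Nat.find (hex (left m)) ↔ j < Nat.find (hex (right m)) := by
    intro j hj
    rw [← hd, ← hd, (glued_left_right.2 hj).node_eq]
  have h2 := h1 (Nat.find (hex (left m)))
  have h3 := h1 (Nat.find (hex (right m)))
  dsimp only
  omega

/-- All branches pass through the root, because every `p_m ≥ 1`; this is the source of locality. -/
lemma IsDepth.eq_zero {d : Fin r → ℕ} (hd : T.IsDepth d) {i : Fin r} (hi : d i = 0) : d = 0 := by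
  funext h
  have := hd.lt_iff_of_glued (T.glued_zero i h)
  simp only [Pi.zero_apply]
  omega

lemma IsDepth.exists_isRootedSubtree {d : Fin r → ℕ} (hd : T.IsDepth d) (h0 : d ≠ 0) :
    ∃ V, T.IsRootedSubtree V ∧ T.depthSum d = ∑ v ∈ V, v.2 := by
  classical
  let V : Finset (ℕ × (Fin r → ℕ)) :=
    Finset.univ.biUnion fun h => (Finset.range (d h)).image fun j => (j, T.node h j)
  have hmem : ∀ v, v ∈ V ↔ ∃ i j, j < d i ∧ (j, T.node i j) = v := by
    intro v
    simp [V]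
  have hV : ∀ h j, (j, T.node h j) ∈ V ↔ j < d h := by
    intro h j
    rw [hmem]
    constructor
    · rintro ⟨i, j', hj, heq⟩
      obtain ⟨rfl, h2⟩ := Prod.mk.inj heq
      have h3 : T.Glued i h j' := by
        refine glued_of_node_ne_zero ?_
        rw [h2, node_self]
        exact ((T.E h).pos j').ne'
      exact (hd.lt_iff_of_glued h3).1 hj
    · exact fun H => ⟨h, j, H, rfl⟩
  have hsub : ∀ v ∈ V, ∃ i j, v = (j, T.node i j) := by
    intro v hv
    obtain ⟨i, j, -, h⟩ := (hmem v).1 hv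
    exact ⟨i, j, h.symm⟩
  refine ⟨V, ⟨hsub, fun i => ?_, fun i j H => ?_⟩, (sum_nodes_eq_depthSum hsub hV).symm⟩
  · rw [hV]
    by_contra hi
    exact h0 (hd.eq_zero (i := i) (by omega))
  · rw [hV] at H ⊢
    omega

lemma isMultiplicityTreeOf_iff {S : AddSubmonoid (Fin r → ℕ)} :
    T.IsMultiplicityTreeOf S ↔ ∀ x, x ∈ S ↔ ∃ d, T.IsDepth d ∧ x = T.depthSum d := by
  rw [IsMultiplicityTreeOf, Set.ext_iff]
  refine forall_congr' fun x => ?_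
  rw [SetLike.mem_coe]
  have : x ∈ ({0} ∪ {x | ∃ V, T.IsRootedSubtree V ∧ x = ∑ v ∈ V, v.2} : Set (Fin r → ℕ)) ↔
      ∃ d, T.IsDepth d ∧ x = T.depthSum d := by
    constructor
    · rintro (rfl | ⟨V, hV, rfl⟩)
      · exact ⟨0, isDepth_zero, depthSum_zero.symm⟩
      · exact hV.exists_isDepth
    · rintro ⟨d, hd, rfl⟩
      by_cases h0 : d = 0
      · left
        simp [h0]
      · exact Or.inr (hd.exists_isRootedSubtree h0)
  rw [this]

end UntwistedTree
-- Node counts, the Arf semigroup of a compatible tree, and its genus.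
namespace UntwistedTree

variable {r : ℕ} {T : UntwistedTree r}

variable (T) in
/-- The number of nodes of the rooted subtree with a given depth vector. -/
def numNodes (d : Fin r → ℕ) : ℤ :=
  ∑ h, (d h : ℤ) - ∑ m, (min (d (left m)) (T.p m) : ℤ)

-- A gluing class is an interval of branches, so it has one adjacent pair fewer than branches. Hence
-- `numNodes` counts a shared node once.
open Classical in
lemma card_glued (i : Fin r) (j : ℕ) :
    (Finset.univ.filter fun h => T.Glued i h j).card =
      (Finset.univ.filter fun m => T.Glued i (left m) j ∧ j < T.p m).card + 1 := by
  have hi : i ∈ Finset.univ.filter fun h => T.Glued i h j := by simp [T.glued_refl]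
  rw [← Finset.card_erase_add_one hi, Nat.add_right_cancel_iff, eq_comm]
  have hright : ∀ m, T.Glued i (left m) j ∧ j < T.p m → T.Glued i (right m) j :=
    fun m h => h.1.trans (glued_left_right.2 h.2)
  -- Each branch other than `i` is matched with the pair joining it to its neighbour on the side of
  -- `i`.
  refine Finset.card_bij (fun m _ => if (m : ℕ) < i then left m else right m) ?_ ?_ ?_
  · intro m hm
    simp only [Finset.mem_filter, Finset.mem_univ, true_and] at hm
    simp only [Finset.mem_erase, Finset.mem_filter, Finset.mem_univ, true_and]
    split_ifs with h
    · exact ⟨fun h' => by simp [← h'] at h, hm.1⟩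
    · exact ⟨fun h' => by simp [← h'] at h, hright m hm⟩
  · intro m _ m' _ h
    apply Fin.ext
    have h := congrArg Fin.val h
    split_ifs at h <;> simp only [val_left, val_right] at h <;> omega
  · intro h hh
    simp only [Finset.mem_erase, Finset.mem_filter, Finset.mem_univ, true_and] at hh
    have hne : (h : ℕ) ≠ i := fun h' => hh.1 (Fin.ext h')
    rcases lt_or_gt_of_ne hne with hlt | hlt
    · let m : Fin (r - 1) := ⟨h, by omega⟩
      have hm : left m = h := rfl
      refine ⟨m, ?_, if_pos hlt⟩
      simp only [Finset.mem_filter, Finset.mem_univ, true_and, hm]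
      exact ⟨hh.2, hh.2 m (by simp only [m]; omega) (by simp only [m]; omega)⟩
    · let m : Fin (r - 1) := ⟨h - 1, by omega⟩
      have hm : right m = h := Fin.ext (by simp [m]; omega)
      have hp : j < T.p m := hh.2 m (by simp only [m]; omega) (by simp only [m]; omega)
      refine ⟨m, ?_, ?_⟩
      · simp only [Finset.mem_filter, Finset.mem_univ, true_and]
        exact ⟨hh.2.trans (hm ▸ (glued_left_right.2 hp).symm), hp⟩
      · simp only [hm]
        exact if_neg (by simp [m]; omega)

/-- A rooted subtree can be enlarged one node at a time inside a larger one. -/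
lemma IsDepth.exists_numNodes_eq_add_one {d d' : Fin r → ℕ} (hd : T.IsDepth d)
    (hd' : T.IsDepth d') (hlt : d < d') :
    ∃ e, T.IsDepth e ∧ d < e ∧ e ≤ d' ∧ T.numNodes e = T.numNodes d + 1 := by
  classical
  obtain ⟨hle, i, hi⟩ := Pi.lt_def.1 hlt
  obtain ⟨j, hj⟩ : ∃ j, d i = j := ⟨_, rfl⟩
  -- The new node is the one at level `j` on branch `i`; every branch through it has the same depth
  -- `j`, so all of them are raised together.
  have hglue : ∀ h, T.Glued i h j → d h = j ∧ j < d' h := by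
    intro h H
    have h1 := hd.lt_iff_of_glued H
    have h2 := (hd'.lt_iff_of_glued H).1 (by omega)
    refine ⟨?_, h2⟩
    rcases Nat.eq_zero_or_pos j with h0 | h0
    · omega
    · have h3 := hd.lt_iff_of_glued (H.mono (j' := j - 1) (by omega))
      omega
  have hlr : ∀ m, j < T.p m → (T.Glued i (left m) j ↔ T.Glued i (right m) j) := fun m hm =>
    ⟨fun H => H.trans (glued_left_right.2 hm), fun H => H.trans (glued_left_right.2 hm).symm⟩
  refine ⟨fun h => d h + if T.Glued i h j then 1 else 0, ?_, ?_, ?_, ?_⟩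
  · intro m
    have h1 := hlr m
    have h2 := hglue (left m)
    have h3 := hglue (right m)
    have h4 := hd m
    by_cases hl : T.Glued i (left m) j <;> by_cases hr : T.Glued i (right m) j <;>
      simp only [hl, hr, if_true, if_false, iff_true, iff_false, true_imp_iff, false_imp_iff,
        not_true_eq_false, imp_false, not_lt] at h1 h2 h3 ⊢ <;> omega
  · refine Pi.lt_def.2 ⟨fun h => Nat.le_add_right _ _, i, ?_⟩
    simp [T.glued_refl]
  · intro h
    have h1 := hle h
    have h2 := hglue h
    dsimp only
    split_ifs with H
    · have := h2 H
      omega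
    · exact h1
  · have h1 : ∀ m : Fin (r - 1), min ((d (left m) : ℤ) + if T.Glued i (left m) j then 1 else 0)
        (T.p m : ℤ) = min (d (left m) : ℤ) (T.p m : ℤ) +
          if T.Glued i (left m) j ∧ j < T.p m then 1 else 0 := by
      intro m
      have h2 := hglue (left m)
      by_cases hl : T.Glued i (left m) j
      · have := h2 hl
        simp only [hl, if_true, true_and]
        split_ifs <;> omega
      · simp [hl]
    have h2 := card_glued (T := T) i j
    simp only [numNodes, h1, Finset.sum_add_distrib, Nat.cast_add, Nat.cast_ite, Nat.cast_one,
      Nat.cast_zero, Finset.sum_boole, h2]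
    ring

lemma IsMultiplicityTreeOf.length_eq {S : AddSubmonoid (Fin r → ℕ)} (hS : T.IsMultiplicityTreeOf S)
    {d : Fin r → ℕ} {n : ℕ}
    (h : HasSaturatedChain (S : Set (Fin r → ℕ)) 0 (T.depthSum d) n) :
    (n : ℤ) = T.numNodes d := by
  rw [isMultiplicityTreeOf_iff] at hS
  have hinv : ∀ d, Function.invFun T.depthSum (T.depthSum d) = d :=
    Function.leftInverse_invFun depthSum_injective
  rw [h.length_eq (R := fun x => T.numNodes (Function.invFun T.depthSum x)), ← T.depthSum_zero,
    hinv, hinv]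
  · simp [numNodes]
  · intro a ha b hb hab
    obtain ⟨d, hd, rfl⟩ := (hS a).1 ha
    obtain ⟨d', hd', rfl⟩ := (hS b).1 hb
    obtain ⟨e, he, h1, h2, h3⟩ := hd.exists_numNodes_eq_add_one hd' (depthSum_lt.1 hab)
    refine ⟨T.depthSum e, (hS _).2 ⟨e, he, rfl⟩, depthSum_lt.2 h1, depthSum_le.2 h2, ?_⟩
    simp only [hinv, h3]

variable (T) in
/-- Adjacent branches are glued at most up to the level at which their multiplicity sequences are
compatible. -/
def IsCompatible : Prop := ∀ m, (T.p m : ℕ∞) ≤ Comp (T.E (left m)) (T.E (right m))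

variable (T) in
/-- The genus of the Arf semigroup with multiplicity tree `T`. -/
noncomputable def genus : ℤ := ∑ h, (T.E h).genus + ∑ m, (T.p m : ℤ)

lemma isDepth_const (j : ℕ) : T.IsDepth fun _ => j := fun _ => rfl

/-- The Arf property is applied with `α` the sum of the first `j` levels and `x = y` the vector of
entries of the next level. The resulting element has depth `sumEnd j` on each branch, and its gluing
condition is compatibility at `j`. -/
lemma IsMultiplicityTreeOf.isCompatible {S : AddSubmonoid (Fin r → ℕ)}
    (hS : T.IsMultiplicityTreeOf S) (hA : IsArfSemigroup S) : T.IsCompatible := by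
  rw [isMultiplicityTreeOf_iff] at hS
  intro m
  rw [MultSeq.le_comp_iff]
  intro j
  have hx : T.depthSum (fun _ => j) + (fun h => (T.E h).seq j) = T.depthSum fun _ => j + 1 :=
    funext fun h => ((T.E h).psum_succ j).symm
  have hmem := (hS _).2 ⟨_, isDepth_const (T := T) (j + 1), rfl⟩
  rw [← hx] at hmem
  obtain ⟨d, hd, h1⟩ := (hS _).1 (hA _ ((hS _).2 ⟨_, isDepth_const j, rfl⟩) _ _ hmem hmem)
  have h2 : ∀ h, d h = (T.E h).sumEnd j := by
    intro h
    have h3 := congrFun h1 h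
    have h4 := (T.E h).psum_succ j
    have h5 := (T.E h).psum_sumEnd j
    rw [← (T.E h).psum_inj]
    simp only [depthSum, Pi.add_apply] at h3
    omega
  rw [← h2, ← h2]
  exact hd m

lemma IsDepth.inf {d d' : Fin r → ℕ} (hd : T.IsDepth d) (hd' : T.IsDepth d') :
    T.IsDepth (d ⊓ d') := by
  intro m
  have := hd m
  have := hd' m
  simp only [Pi.inf_apply]
  omega

lemma depthSum_inf (d d' : Fin r → ℕ) : T.depthSum (d ⊓ d') = T.depthSum d ⊓ T.depthSum d' :=
  funext fun h => (T.E h).psum_strictMono.monotone.map_min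

/-- The Arf property of a compatible tree. -/
lemma IsCompatible.exists_depthSum_add (hT : T.IsCompatible) {a b c : Fin r → ℕ}
    (ha : T.IsDepth a) (hb : T.IsDepth b) (hc : T.IsDepth c) (hab : a ≤ b) (hac : a ≤ c) :
    ∃ e, T.IsDepth e ∧ T.depthSum e + T.depthSum a = T.depthSum b + T.depthSum c := by
  choose e he using fun h => (T.E h).exists_psum_eq (hab h) (hac h)
  exact ⟨e, fun m => MultSeq.min_eq_min_of_psum (MultSeq.le_comp_iff.1 (hT m)) (ha m) (hb m) (hc m)
    (hab _) (hac _) (hab _) (hac _) (he _) (he _), funext he⟩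

/-- The semigroup of a compatible tree. -/
def IsCompatible.semigroup (hT : T.IsCompatible) : AddSubmonoid (Fin r → ℕ) where
  carrier := {x | ∃ d, T.IsDepth d ∧ x = T.depthSum d}
  zero_mem' := ⟨0, isDepth_zero, depthSum_zero.symm⟩
  add_mem' := by
    rintro _ _ ⟨b, hb, rfl⟩ ⟨c, hc, rfl⟩
    -- A plain sum is the Arf operation based at depth zero.
    obtain ⟨e, he, h⟩ := hT.exists_depthSum_add isDepth_zero hb hc (bot_le) (bot_le)
    exact ⟨e, he, by simpa using h.symm⟩

lemma IsCompatible.isArfSemigroup (hT : T.IsCompatible) : IsArfSemigroup hT.semigroup := by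
  rintro _ ⟨a, ha, rfl⟩ x y ⟨b, hb, hx⟩ ⟨c, hc, hy⟩
  have hab : a ≤ b := depthSum_le.1 (hx ▸ le_self_add)
  have hac : a ≤ c := depthSum_le.1 (hy ▸ le_self_add)
  obtain ⟨e, he, h⟩ := hT.exists_depthSum_add ha hb hc hab hac
  refine ⟨e, he, ?_⟩
  rw [← hx, ← hy] at h
  funext i
  have := congrFun h i
  simp only [Pi.add_apply] at this ⊢
  omega

lemma IsCompatible.isLocalSemigroup (hT : T.IsCompatible) : IsLocalSemigroup hT.semigroup := by
  rintro _ ⟨a, ha, rfl⟩ ⟨i, hi⟩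
  have : a i = 0 := (T.E i).psum_inj.1 (by simpa [depthSum] using hi)
  rw [ha.eq_zero this, depthSum_zero]

variable (T) in
/-- The depth vector of the conductor. -/
noncomputable def conductorDepth : Fin r → ℕ := fun h =>
  max (T.E h).onset (Finset.univ.sup fun m => if left m = h ∨ right m = h then T.p m else 0)

lemma le_conductorDepth {m : Fin (r - 1)} {h : Fin r} (hm : left m = h ∨ right m = h) :
    T.p m ≤ T.conductorDepth h := by
  refine le_max_of_le_right ?_
  refine le_trans (le_of_eq ?_) (Finset.le_sup (Finset.mem_univ m))
  rw [if_pos hm]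

lemma conductorDepth_le {d : Fin r → ℕ} (h1 : ∀ h, (T.E h).seq (d h) = 1)
    (h2 : ∀ m, T.p m ≤ d (left m)) (h3 : ∀ m, T.p m ≤ d (right m)) : T.conductorDepth ≤ d := by
  refine fun h => max_le (MultSeq.onset_le (h1 h)) (Finset.sup_le fun m _ => ?_)
  split_ifs with hm
  · rcases hm with rfl | rfl
    · exact h2 m
    · exact h3 m
  · exact Nat.zero_le _

/-- From this depth on all entries are `1` and no gluing constrains, so each coordinate moves freely
by units. -/
lemma exists_eq_depthSum_of_conductorDepth_le {x : Fin r → ℕ}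
    (hx : T.depthSum T.conductorDepth ≤ x) : ∃ d, T.IsDepth d ∧ x = T.depthSum d := by
  refine ⟨fun h => T.conductorDepth h + (x h - T.depthSum T.conductorDepth h), fun m => ?_, ?_⟩
  · have h1 := le_conductorDepth (T := T) (m := m) (Or.inl rfl)
    have h2 := le_conductorDepth (T := T) (m := m) (Or.inr rfl)
    dsimp only
    omega
  · funext h
    have h1 : (T.E h).seq (T.conductorDepth h) = 1 :=
      (T.E h).eq_one_of_le (T.E h).seq_onset (le_max_left _ _)
    have h2 : T.depthSum T.conductorDepth h ≤ x h := hx h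
    rw [depthSum, MultSeq.psum_add_of_eq_one _ h1]
    simp only [depthSum] at h2 ⊢
    omega

lemma IsCompatible.isGoodSemigroup (hT : T.IsCompatible) : IsGoodSemigroup hT.semigroup where
  inf_mem := by
    rintro _ ⟨a, ha, rfl⟩ _ ⟨b, hb, rfl⟩
    exact ⟨a ⊓ b, ha.inf hb, (depthSum_inf a b).symm⟩
  exists_gt := by
    rintro _ ⟨a, ha, rfl⟩ _ ⟨b, hb, rfl⟩ i hi
    -- Every coordinate where the depths agree is raised, not only `i`, so that glued branches stay
    -- level. If just one of two adjacent branches is raised, both are already at depth at least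
    -- `p`.
    let e : Fin r → ℕ := fun h => if a h = b h then a h + 1 else min (a h) (b h)
    have hinf : ∀ j, min (T.depthSum a j) (T.depthSum b j) = (T.E j).psum (min (a j) (b j)) :=
      fun j => congrFun (depthSum_inf a b).symm j
    have hi' : a i = b i := (T.E i).psum_inj.1 hi
    refine ⟨T.depthSum e, ⟨e, fun m => ?_, rfl⟩, ?_, fun j _ => ?_, fun j _ hj => ?_⟩
    · have := ha m
      have := hb m
      simp only [e]
      split_ifs <;> omega
    · refine (T.E i).psum_strictMono ?_
      simp [e, hi']
    · rw [hinf]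
      refine (T.E j).psum_le.2 ?_
      simp only [e]
      split_ifs <;> omega
    · rw [hinf]
      have : a j ≠ b j := fun h => hj (by simp only [depthSum, h])
      simp [e, depthSum, this]
  exists_cone := ⟨_, exists_eq_depthSum_of_conductorDepth_le le_rfl,
    fun _ => exists_eq_depthSum_of_conductorDepth_le⟩

lemma IsCompatible.isMultiplicityTreeOf (hT : T.IsCompatible) :
    T.IsMultiplicityTreeOf hT.semigroup := isMultiplicityTreeOf_iff.2 fun _ => Iff.rfl

/-- The depth vectors of elements above which everything belongs to the semigroup. -/
lemma IsMultiplicityTreeOf.of_cone {S : AddSubmonoid (Fin r → ℕ)} (hS : T.IsMultiplicityTreeOf S)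
    {d : Fin r → ℕ} (hd : T.IsDepth d) (hc : ∀ x, T.depthSum d ≤ x → x ∈ S) :
    (∀ h, (T.E h).seq (d h) = 1) ∧ (∀ m, T.p m ≤ d (left m)) ∧ ∀ m, T.p m ≤ d (right m) := by
  rw [isMultiplicityTreeOf_iff] at hS
  -- Adding a unit vector stays in `S`, so it must add a single node of multiplicity `1` on branch
  -- `h` alone.
  have h1 : ∀ h, (T.E h).seq (d h) = 1 ∧ T.IsDepth (d + Pi.single h 1) := by
    intro h
    obtain ⟨e, he, hx⟩ := (hS (T.depthSum d + Pi.single h 1)).1 (hc _ le_self_add)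
    have hle : d ≤ e := depthSum_le.1 (hx ▸ le_self_add)
    have h2 : (T.E h).psum (d h) + 1 = (T.E h).psum (e h) := by
      simpa [depthSum] using congrFun hx h
    have h3 : d h < e h := (T.E h).psum_strictMono.lt_iff_lt.1 (by omega)
    have h4 := (T.E h).psum_succ (d h)
    have h5 : (T.E h).psum (d h + 1) ≤ _ := (T.E h).psum_le.2 h3
    have h6 := (T.E h).pos (d h)
    have h7 : (T.E h).seq (d h) = 1 := by omega
    have h8 : e h = d h + 1 := (T.E h).psum_inj.1 (by omega)
    have h9 : e = d + Pi.single h 1 := by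
      funext k
      by_cases hk : k = h
      · subst hk
        simpa using h8
      · have := congrFun hx k
        simp only [depthSum, Pi.add_apply, Pi.single_eq_of_ne hk, add_zero,
          MultSeq.psum_inj] at this ⊢
        exact this.symm
    exact ⟨h7, h9 ▸ he⟩
  have h2 : ∀ m, T.p m ≤ d (left m) := by
    intro m
    have h3 := hd m
    have h4 := (h1 (left m)).2 m
    have h5 : right m ≠ left m := fun h => by simpa using congrArg Fin.val h
    simp only [Pi.add_apply, Pi.single_eq_same, Pi.single_eq_of_ne h5] at h4
    omega
  refine ⟨fun h => (h1 h).1, h2, fun m => ?_⟩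
  have := h2 m
  have := hd m
  omega

/-- The chains have lengths `∑ psum (d h)` and `numNodes d`. At the conductor each `min (d (left m))
(p m)` is `p m`, which leaves the formula. -/
lemma IsMultiplicityTreeOf.eq_genus {S : AddSubmonoid (Fin r → ℕ)} (hS : T.IsMultiplicityTreeOf S)
    {g : ℤ} (hg : HasGenus S g) : g = T.genus := by
  obtain ⟨δ, hδ, d₁, d₂, h1, h2, rfl⟩ := hg
  obtain ⟨d, hd, rfl⟩ := (isMultiplicityTreeOf_iff.1 hS δ).1 (hδ.1 δ le_rfl)
  obtain ⟨h3, h4, -⟩ := hS.of_cone hd hδ.1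
  rw [length_eq_of_hasSaturatedChain_univ h1, hS.length_eq h2, numNodes, genus]
  have h5 : ∀ m : Fin (r - 1), (min (d (left m)) (T.p m) : ℤ) = T.p m := fun m => by
    have := h4 m
    omega
  simp only [h5, fun h => MultSeq.genus_eq (h3 h), Finset.sum_sub_distrib, depthSum]
  ring

lemma IsCompatible.hasGenus (hT : T.IsCompatible) : HasGenus hT.semigroup T.genus := by
  have hc : IsConductor hT.semigroup (T.depthSum T.conductorDepth) := by
    refine ⟨fun x => exists_eq_depthSum_of_conductorDepth_le, fun c hc => ?_⟩
    obtain ⟨d, hd, rfl⟩ := hc c le_rfl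
    obtain ⟨h1, h2, h3⟩ := hT.isMultiplicityTreeOf.of_cone hd hc
    exact depthSum_le.2 (conductorDepth_le h1 h2 h3)
  obtain ⟨d₁, h1⟩ := exists_hasSaturatedChain (S := Set.univ)
    (Set.mem_univ (0 : Fin r → ℕ)) (Set.mem_univ (T.depthSum T.conductorDepth)) (bot_le)
  obtain ⟨d₂, h2⟩ := exists_hasSaturatedChain (S := (hT.semigroup : Set (Fin r → ℕ)))
    hT.semigroup.zero_mem (hc.1 _ le_rfl) (bot_le)
  have h : HasGenus hT.semigroup ((d₁ : ℤ) - d₂) := ⟨_, hc, d₁, d₂, h1, h2, rfl⟩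
  rwa [← hT.isMultiplicityTreeOf.eq_genus h]

/-- The multiplicity trees of local Arf good semigroups are the compatible ones, and the genus of the
semigroup can be read off from the tree. -/
lemma mem_gen_iff {n : ℤ} : T ∈ Gen r n ↔ T.IsCompatible ∧ n = T.genus := by
  constructor
  · rintro ⟨S, -, -, hA, hS, hg⟩
    exact ⟨hS.isCompatible hA, hS.eq_genus hg⟩
  · rintro ⟨hT, rfl⟩
    exact ⟨hT.semigroup, hT.isGoodSemigroup, hT.isLocalSemigroup, hT.isArfSemigroup,
      hT.isMultiplicityTreeOf, hT.hasGenus⟩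

end UntwistedTree
-- Cutting and reversing trees.
namespace UntwistedTree

variable {r : ℕ} (T : UntwistedTree r)

lemma genus_eq_take_add_drop {t : ℕ} (ht : 1 ≤ t) (htr : t < r) :
    T.genus = (T.take t htr.le).genus + T.p ⟨t - 1, by omega⟩ + (T.drop t).genus := by
  -- Extension by `0` to all of `ℕ` turns the sums into `range` sums, which split at `t`; the
  -- default is never summed.
  let G : ℕ → ℤ := fun i => if h : i < r then (T.E ⟨i, h⟩).genus else 0
  let P : ℕ → ℤ := fun m => if h : m < r - 1 then (T.p ⟨m, h⟩ : ℤ) else 0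
  have hG : ∀ (i : ℕ) (h : i < r), (T.E ⟨i, h⟩).genus = G i := fun i h => by simp [G, h]
  have hP : ∀ (m : ℕ) (h : m < r - 1), (T.p ⟨m, h⟩ : ℤ) = P m := fun m h => by simp [P, h]
  have h1 : T.genus = ∑ i ∈ Finset.range r, G i + ∑ m ∈ Finset.range (r - 1), P m := by
    rw [Finset.sum_range, Finset.sum_range]
    exact congrArg₂ _ (Finset.sum_congr rfl fun i _ => hG i i.2)
      (Finset.sum_congr rfl fun m _ => hP m m.2)
  have h2 : (T.take t htr.le).genus =
      ∑ i ∈ Finset.range t, G i + ∑ m ∈ Finset.range (t - 1), P m := by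
    rw [Finset.sum_range, Finset.sum_range]
    exact congrArg₂ _ (Finset.sum_congr rfl fun i _ => hG i (by omega))
      (Finset.sum_congr rfl fun m _ => hP m (by omega))
  have h3 : (T.drop t).genus =
      ∑ i ∈ Finset.range (r - t), G (t + i) + ∑ m ∈ Finset.range (r - t - 1), P (t + m) := by
    rw [Finset.sum_range, Finset.sum_range]
    exact congrArg₂ _ (Finset.sum_congr rfl fun i _ => hG (t + i) (by omega))
      (Finset.sum_congr rfl fun m _ => hP (t + m) (by omega))
  have h4 := Finset.sum_range_add G t (r - t)
  have h5 := Finset.sum_range_add P t (r - t - 1)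
  have h6 := Finset.sum_range_succ P (t - 1)
  rw [Nat.add_sub_cancel' htr.le] at h4
  rw [show t + (r - t - 1) = r - 1 by omega] at h5
  rw [Nat.sub_add_cancel ht] at h6
  rw [h1, h2, h3, hP, h4, h5, h6]
  ring

lemma isCompatible_iff_split {t : ℕ} (ht : 1 ≤ t) (htr : t < r) :
    T.IsCompatible ↔ (T.take t htr.le).IsCompatible ∧ (T.drop t).IsCompatible ∧
      (T.p ⟨t - 1, by omega⟩ : ℕ∞) ≤ Comp (T.E ⟨t - 1, by omega⟩) (T.E ⟨t, htr⟩) := by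
  have ht1 : t - 1 + 1 = t := by omega
  constructor
  · intro h
    refine ⟨fun m => h ⟨m, by omega⟩, fun m => h ⟨t + m, by omega⟩, ?_⟩
    have := h ⟨t - 1, by omega⟩
    simpa only [left, right, ht1] using this
  · rintro ⟨h1, h2, h3⟩ ⟨m, hmr⟩
    rcases lt_trichotomy m (t - 1) with hm | rfl | hm
    · exact h1 ⟨m, hm⟩
    · simpa only [left, right, ht1] using h3
    · obtain ⟨x, rfl⟩ := Nat.exists_eq_add_of_le (show t ≤ m by omega)
      exact h2 ⟨x, by omega⟩

@[simp] lemma reverse_reverse : T.reverse.reverse = T := by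
  ext1 <;> funext i <;> simp [reverse]

lemma left_rev (m : Fin (r - 1)) : left m.rev = (right m).rev :=
  Fin.ext (by simp only [val_left, val_right, Fin.val_rev]; omega)

lemma right_rev (m : Fin (r - 1)) : right m.rev = (left m).rev :=
  Fin.ext (by simp only [val_left, val_right, Fin.val_rev]; omega)

lemma genus_reverse : T.reverse.genus = T.genus :=
  congrArg₂ _ (Equiv.sum_comp Fin.revPerm fun i => (T.E i).genus)
    (Equiv.sum_comp Fin.revPerm fun m => (T.p m : ℤ))

variable {T}

lemma IsCompatible.reverse (hT : T.IsCompatible) : T.reverse.IsCompatible := by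
  intro m
  have := hT m.rev
  rw [left_rev, right_rev, MultSeq.comp_comm] at this
  exact this

lemma reverse_mem_gen {n : ℤ} (hT : T ∈ Gen r n) : T.reverse ∈ Gen r n := by
  rw [mem_gen_iff] at hT ⊢
  exact ⟨hT.1.reverse, by rw [genus_reverse, hT.2]⟩

variable (T)

lemma sub_one_le_genus : (r : ℤ) - 1 ≤ T.genus := by
  have h1 : 0 ≤ ∑ h, (T.E h).genus := Finset.sum_nonneg fun h _ => (T.E h).genus_nonneg
  have h2 : ∑ _m : Fin (r - 1), (1 : ℤ) ≤ ∑ m, (T.p m : ℤ) :=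
    Finset.sum_le_sum fun m _ => by exact_mod_cast T.p_pos m
  rw [Finset.sum_const, Finset.card_univ, Fintype.card_fin] at h2
  simp only [nsmul_eq_mul, mul_one] at h2
  rw [genus]
  omega

variable {T}

/-- Membership in `I_r^n(t, p, k)` in terms of the whole tree. -/
lemma mem_iSet_iff {n : ℤ} {t p : ℕ} {k : ℤ} (ht : 1 ≤ t) (htr : t < r) :
    T ∈ ISet r n t p k ht htr ↔ T ∈ Gen r n ∧ T.p ⟨t - 1, by omega⟩ = p ∧
      (T.take t htr.le).genus = k := by
  have hg := T.genus_eq_take_add_drop ht htr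
  simp only [ISet, Set.mem_ofPred_eq, mem_gen_iff]
  rw [T.isCompatible_iff_split ht htr]
  constructor
  · rintro ⟨⟨h1, h2⟩, ⟨h3, h4⟩, rfl, h6⟩
    exact ⟨⟨⟨h1, h3, h6⟩, by omega⟩, rfl, h2.symm⟩
  · rintro ⟨⟨⟨h1, h2, h3⟩, h4⟩, rfl, rfl⟩
    exact ⟨⟨h1, rfl⟩, ⟨h2, by omega⟩, rfl, h3⟩

lemma genus_take_eq_of_eq {t : ℕ} (h : t = r) : (T.take t h.le).genus = T.genus := by
  subst h
  rfl

variable (T)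

/-- As the last `t` branches lie in `T.drop t`, the cut formula can be applied a second time, to the
reversed right part. -/
lemma take_reverse {t : ℕ} (htr : t ≤ r - t) :
    T.reverse.take t (by omega) = (T.drop t).reverse.take t htr := by
  ext1
  · funext i
    refine congrArg T.E (Fin.ext ?_)
    simp only [Fin.val_rev]
    omega
  · funext m
    refine congrArg T.p (Fin.ext ?_)
    simp only [Fin.val_rev]
    omega

/-- The first `t` and the last `t` branches of a tree are disjoint if `2 * t ≤ r`. -/
lemma genus_take_add_genus_take_reverse_le {t : ℕ} (ht : 1 ≤ t) (htr : 2 * t ≤ r) :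
    (2 * t = r ∧ T.p ⟨t - 1, by omega⟩ = T.reverse.p ⟨t - 1, by omega⟩ ∧
      (T.take t (by omega)).genus + T.p ⟨t - 1, by omega⟩ + (T.reverse.take t (by omega)).genus =
        T.genus) ∨
    (T.take t (by omega)).genus + T.p ⟨t - 1, by omega⟩ + T.reverse.p ⟨t - 1, by omega⟩ +
      (T.reverse.take t (by omega)).genus ≤ T.genus := by
  have h1 := T.genus_eq_take_add_drop ht (show t < r by omega)
  rw [← (T.drop t).genus_reverse] at h1
  rw [T.take_reverse (show t ≤ r - t by omega)]
  rcases htr.eq_or_lt with h | h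
  · left
    refine ⟨h, congrArg T.p (Fin.ext ?_), ?_⟩
    · simp only [Fin.val_rev]
      omega
    · rw [genus_take_eq_of_eq (T := (T.drop t).reverse) (by omega), h1]
  · right
    have h2 := (T.drop t).reverse.genus_eq_take_add_drop ht (show t < r - t by omega)
    -- The middle block has `r - 2t ≥ 1` branches, so its genus is nonnegative.
    have h3 := ((T.drop t).reverse.drop t).sub_one_le_genus
    have h4 : (T.drop t).reverse.p ⟨t - 1, by omega⟩ = T.reverse.p ⟨t - 1, by omega⟩ := by
      refine congrArg T.p (Fin.ext ?_)
      simp only [Fin.val_rev]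
      omega
    rw [h4] at h2
    omega

end UntwistedTree

/-! ### The decomposition of `Gen r n`. -/

theorem mainTheorem3 (r n t : ℕ) (ht : 1 ≤ t) (htr : 2 * t ≤ r) (lam : ℕ → ℤ)
    (hlam : ∀ p : ℕ, 1 ≤ p → (p : ℤ) ≤ (n : ℤ) - r + 2 →
      ((n : ℚ) - p - 1) / 2 ≤ (lam p : ℚ)) :
    Gen r n =
      ⋃ (p : ℕ) (_ : 1 ≤ p ∧ (p : ℤ) ≤ (n : ℤ) - r + 2)
        (k : ℤ) (_ : (t : ℤ) - 1 ≤ k ∧ k ≤ lam p),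
        (ISet r n t p k ht (by omega) ∪
          UntwistedTree.reverse '' ISet r n t p k ht (by omega)) := by
  ext T
  simp only [Set.mem_iUnion, Set.mem_union, Set.mem_image, exists_prop,
    UntwistedTree.mem_iSet_iff]
  have hrange : ∀ U : UntwistedTree r, U ∈ Gen r n →
      1 ≤ U.p ⟨t - 1, by omega⟩ ∧ (U.p ⟨t - 1, by omega⟩ : ℤ) ≤ (n : ℤ) - r + 2 ∧
        (t : ℤ) - 1 ≤ (U.take t (by omega)).genus := by
    intro U hU
    have h1 := U.genus_eq_take_add_drop ht (show t < r by omega)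
    have h2 := (U.take t (by omega)).sub_one_le_genus
    have h3 := (U.drop t).sub_one_le_genus
    have h4 := (UntwistedTree.mem_gen_iff.1 hU).2
    exact ⟨U.p_pos _, by omega, h2⟩
  have hlam' : ∀ p : ℕ, 1 ≤ p → (p : ℤ) ≤ (n : ℤ) - r + 2 → (n : ℤ) - p - 1 ≤ 2 * lam p := by
    intro p h1 h2
    have h3 := hlam p h1 h2
    rw [div_le_iff₀ two_pos] at h3
    have h4 : (n : ℤ) - p - 1 ≤ lam p * 2 := by exact_mod_cast h3
    omega
  constructor
  · intro hT
    obtain ⟨h1, h2, h3⟩ := hrange T hT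
    by_cases hk : (T.take t (by omega)).genus ≤ lam (T.p ⟨t - 1, by omega⟩)
    · exact ⟨_, ⟨h1, h2⟩, _, ⟨h3, hk⟩, Or.inl ⟨hT, rfl, rfl⟩⟩
    have hT' := UntwistedTree.reverse_mem_gen hT
    obtain ⟨h1', h2', h3'⟩ := hrange T.reverse hT'
    refine ⟨_, ⟨h1', h2'⟩, _, ⟨h3', ?_⟩,
      Or.inr ⟨T.reverse, ⟨hT', rfl, rfl⟩, T.reverse_reverse⟩⟩
    have h4 := (UntwistedTree.mem_gen_iff.1 hT).2
    have h5 := hlam' _ h1 h2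
    have h6 := hlam' _ h1' h2'
    -- If both bounds fail, integrality gives `2k ≥ n - p + 1` and `2k' ≥ n - p' + 1`, so `2(k + k')
    -- + p + p' ≥ 2n + 2`, impossible in either case.
    rcases T.genus_take_add_genus_take_reverse_le ht htr with ⟨-, h7, h8⟩ | h7
    · rw [← h7] at h6 ⊢
      omega
    · omega
  · rintro ⟨p, -, k, -, ⟨hT, -, -⟩ | ⟨U, ⟨hU, -, -⟩, rfl⟩⟩
    · exact hT
    · exact UntwistedTree.reverse_mem_gen hU
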